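/- Let $m$ be a positive integer. Let $I_k=\{1,\dots,m\}^k$ be the set of words of length $k$ ($I_0=\{\emptyset\}$), $I=\bigcup_{k\ge 0} I_k$, and $I_\infty=\{1,\dots,m\}^{\mathbb N}$; for $\mathbf i\in I$ write $|\mathbf i|$ for its length and let $C_{\mathbf i}\subseteq I_\infty$ be the cylinder of all infinite words that have $\mathbf i$ as an initial segment. Let $\{W_{\mathbf i}:\mathbf i\in I\}$ be independent, (almost surely) strictly positive random variables on a probability space, not necessarily identically distributed, with $\mathbb E(W_{\mathbf i})=1$ for each $\mathbf i\in I$, and set $$X_{i_1,\dots,i_k}=W_{i_1}W_{i_1,i_2}\cdots W_{i_1,\dots,i_k},\qquad X_\emptyset=1.$$ Let $\mu$ be a Borel probability measure on $I_\infty$ and put $Y_{\mathbf i}=X_{\mathbf i}\,\mu(C_{\mathbf i})$ for $\mathbf i\in I$. Let $q\ge 1$ be real, and suppose that $$\limsup_{k\to\infty}\Big(\sum_{|\mathbf i|=k}\mathbb E\big(Y_{\mathbf i}^q\big)\Big)^{1/k}<1 ,$$ where expectations of nonnegative random variables take values in $[0,\infty]$. Then $$\limsup_{k\to\infty}\mathbb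 E\Big(\Big(\sum_{|\mathbf i|=k}Y_{\mathbf i}\Big)^q\Big)<\infty ,\qquad\text{and moreover}\qquad \sup_{k\ge 0}\mathbb E\Big(\Big(\sum_{|\mathbf i|=k}Y_{\mathbf i}\Big)^q\Big)<\infty .$$ -/

import Mathlib

open MeasureTheory ProbabilityTheory Filter

namespace Cascade

/-- The cylinder of the finite word `i` over the alphabet `Fin m`: all infinite words of which `i`
is a curtailment (an initial segment). Infinite words are functions `ℕ → Fin m`; the product
σ-algebra on them is the Borel σ-algebra. -/
def cylinder {m : ℕ} (i : List (Fin m)) : Set (ℕ → Fin m) :=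
  {x | ∀ (r : ℕ) (hr : r < i.length), x r = i[r]}

/-- The multiplicative cascade
`X_{i₁,…,iₖ} = W_{i₁} W_{i₁,i₂} ⋯ W_{i₁,…,iₖ}` (so `X_∅ = 1`). -/
def X {m : ℕ} {Ω : Type*} (W : List (Fin m) → Ω → ℝ) (i : List (Fin m)) (ω : Ω) : ℝ :=
  ∏ r ∈ Finset.range i.length, W (i.take (r + 1)) ω

/-- `Y_i = X_i μ(C_i)`. -/
noncomputable def Y {m : ℕ} {Ω : Type*} (W : List (Fin m) → Ω → ℝ) (μ : Measure (ℕ → Fin m))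
    (i : List (Fin m)) (ω : Ω) : ℝ :=
  X W i ω * μ.real (cylinder i)

end Cascade

/-! Let `M k` be the total `q`-th moment of level `k`. Splitting the level sum by first letter gives
independent summands, each a weight times an independent cascade on a subtree. A Rosenthal
inequality (`exists_lintegral_sum_rpow_le`) bounds the `q`-th moment of a sum by `s ^ 2` times the
sum of the `q`-th moments plus `K` times the `q`-th power of the mean. Means are conserved along the
tree, so iteration (`exists_lintegral_treeSum_rpow_le`) bounds the moment at level `n` by a constant
times `∑ j ≤ n, s ^ (2 * j) * M j`. The factor `s ^ 2` compounds at every level, hence the need for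
it to be near `1`: as `M` decays geometrically, a suitable `s > 1` keeps the series convergent
(`exists_tsum_pow_mul_lt_top`). -/

namespace Cascade

open scoped ENNReal NNReal

/-! ### Elementary inequalities and the Rosenthal type estimate -/

/-- Subadditivity of `x ↦ x ^ p` up to a constant, with leading constant `s` arbitrarily close
to `1`. -/
theorem exists_add_rpow_le {p : ℝ} (hp : 0 ≤ p) {s : ℝ≥0} (hs : 1 < s) :
    ∃ C : ℝ≥0, ∀ x y : ℝ≥0∞, (x + y) ^ p ≤ s * x ^ p + C * y ^ p := by
  rcases hp.eq_or_lt with rfl | hp0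
  · refine ⟨0, fun x y => ?_⟩
    simpa using hs.le
  set t : ℝ≥0 := s ^ (1 / p) with ht
  have ht1 : 1 < t := NNReal.one_lt_rpow hs (by positivity)
  have htp : t ^ p = s := by rw [ht, ← NNReal.rpow_mul]; field_simp; simp
  set d : ℝ≥0 := t - 1 with hd
  have hd0 : d ≠ 0 := (tsub_pos_of_lt ht1).ne'
  have hd1 : 1 + d = t := add_tsub_cancel_of_le ht1.le
  refine ⟨(d⁻¹ + 1) ^ p, fun x y => ?_⟩
  -- If `y` is small against `x`, then `x + y ≤ t * x` with `t ^ p = s`; otherwise `y` dominates.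
  rcases le_total y (d * x) with h | h
  · calc (x + y) ^ p ≤ (t * x) ^ p := by
          gcongr
          rw [← hd1]; push_cast; rw [add_mul, one_mul]; gcongr
      _ = s * x ^ p := by
          rw [ENNReal.mul_rpow_of_nonneg _ _ hp, ← ENNReal.coe_rpow_of_nonneg _ hp, htp]
      _ ≤ _ := le_self_add
  · have hx : x ≤ d⁻¹ * y := by
      calc x = ((d⁻¹ * d : ℝ≥0) : ℝ≥0∞) * x := by rw [inv_mul_cancel₀ hd0]; simp
        _ = ((d⁻¹ : ℝ≥0) : ℝ≥0∞) * (d * x) := by push_cast; rw [mul_assoc]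
        _ ≤ _ := by gcongr
    calc (x + y) ^ p ≤ (((d⁻¹ + 1 : ℝ≥0) : ℝ≥0∞) * y) ^ p := by
          gcongr
          push_cast; rw [add_mul, one_mul]; gcongr
      _ = (((d⁻¹ + 1) ^ p : ℝ≥0) : ℝ≥0∞) * y ^ p := by
          rw [ENNReal.mul_rpow_of_nonneg _ _ hp, ← ENNReal.coe_rpow_of_nonneg _ hp]
      _ ≤ _ := le_add_self

/-- A Young type inequality: the cross term of the Rosenthal estimate becomes a small, absorbable
multiple of the full moment. -/
theorem mul_rpow_le_add {p : ℝ} (hp : 0 ≤ p) {d : ℝ≥0} (hd : d ≠ 0) (c x : ℝ≥0∞) :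
    c * x ^ p ≤ d * x ^ (1 + p) + ((d⁻¹ ^ p : ℝ≥0) : ℝ≥0∞) * c ^ (1 + p) := by
  simp only [ENNReal.rpow_add_of_nonneg _ _ zero_le_one hp, ENNReal.rpow_one]
  rcases le_total c (d * x) with h | h
  · calc c * x ^ p ≤ d * x * x ^ p := by gcongr
      _ = d * (x * x ^ p) := mul_assoc _ _ _
      _ ≤ _ := le_self_add
  · have hx : x ≤ d⁻¹ * c := by
      calc x = ((d⁻¹ * d : ℝ≥0) : ℝ≥0∞) * x := by rw [inv_mul_cancel₀ hd]; simp
        _ = ((d⁻¹ : ℝ≥0) : ℝ≥0∞) * (d * x) := by push_cast; rw [mul_assoc]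
        _ ≤ ((d⁻¹ : ℝ≥0) : ℝ≥0∞) * c := by gcongr
        _ = _ := by rw [ENNReal.coe_inv hd]
    calc c * x ^ p ≤ c * (((d⁻¹ : ℝ≥0) : ℝ≥0∞) * c) ^ p := by
          gcongr
      _ = ((d⁻¹ ^ p : ℝ≥0) : ℝ≥0∞) * (c * c ^ p) := by
          rw [ENNReal.mul_rpow_of_nonneg _ _ hp, ← ENNReal.coe_rpow_of_nonneg _ hp]; ring
      _ ≤ _ := le_add_self

/-- Absorbing a small multiple of the left-hand side. -/
theorem le_mul_of_le_add {s : ℝ≥0} (hs : 1 < s) {A R : ℝ≥0∞} (hA : A ≠ ∞)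
    (h : A ≤ R + ((1 - s⁻¹ : ℝ≥0) : ℝ≥0∞) * A) : A ≤ s * R := by
  have hs0 : s ≠ 0 := (zero_lt_one.trans hs).ne'
  have hle : s⁻¹ ≤ 1 := inv_le_one_of_one_le₀ hs.le
  have h1 : ((s⁻¹ : ℝ≥0) : ℝ≥0∞) * A ≤ R := by
    have h2 : ((s⁻¹ : ℝ≥0) : ℝ≥0∞) * A + ((1 - s⁻¹ : ℝ≥0) : ℝ≥0∞) * A = A := by
      rw [← add_mul, ← ENNReal.coe_add, add_tsub_cancel_of_le hle]; simp
    have h3 : ((1 - s⁻¹ : ℝ≥0) : ℝ≥0∞) * A ≠ ∞ := ENNReal.mul_ne_top ENNReal.coe_ne_top hA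
    rw [← ENNReal.add_le_add_iff_right h3, h2]
    exact h
  calc A = (s * s⁻¹ : ℝ≥0) * A := by rw [mul_inv_cancel₀ hs0]; simp
    _ = s * ((s⁻¹ : ℝ≥0) * A) := by push_cast; rw [mul_assoc]
    _ ≤ _ := by gcongr

theorem sum_rpow_le_const_mul {ι : Type*} [Fintype ι] (z : ι → ℝ≥0∞) {q : ℝ} (hq : 1 ≤ q) :
    (∑ a, z a) ^ q ≤ (Fintype.card ι : ℝ≥0∞) ^ (q - 1) * ∑ a, z a ^ q := by
  simpa using ENNReal.rpow_sum_le_const_mul_sum_rpow Finset.univ z hq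

/-- A Rosenthal type inequality for nonnegative independent summands, with leading constant
arbitrarily close to `1`. -/
theorem exists_lintegral_sum_rpow_le {ι : Type*} [Fintype ι] [DecidableEq ι]
    {q : ℝ} (hq : 1 ≤ q) {s : ℝ≥0} (hs : 1 < s) :
    ∃ K : ℝ≥0, ∀ {Ω : Type*} [MeasurableSpace Ω] (P : Measure Ω) (Z : ι → Ω → ℝ≥0∞),
      (∀ a, Measurable (Z a)) →
      (∀ a, IndepFun (Z a) (fun ω => ∑ b ∈ Finset.univ.erase a, Z b ω) P) →
      IsProbabilityMeasure P →
      ∫⁻ ω, (∑ a, Z a ω) ^ q ∂P ≤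
        s ^ 2 * ∑ a, ∫⁻ ω, Z a ω ^ q ∂P + K * (∑ a, ∫⁻ ω, Z a ω ∂P) ^ q := by
  obtain ⟨p, rfl⟩ : ∃ p, q = 1 + p := ⟨q - 1, by ring⟩
  have hp : 0 ≤ p := by linarith
  obtain ⟨C, hC⟩ := exists_add_rpow_le hp hs
  have hs0 : s ≠ 0 := (zero_lt_one.trans hs).ne'
  set η : ℝ≥0 := 1 - s⁻¹ with hη
  have hη0 : η ≠ 0 := (tsub_pos_of_lt (inv_lt_one_of_one_lt₀ hs)).ne'
  -- Makes `C * d ≤ 1 - s⁻¹`, so that absorption costs one factor `s`; the other factor in `s ^ 2`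
  -- comes from `hC`.
  set d : ℝ≥0 := η / (C + 1) with hd
  have hd0 : d ≠ 0 := div_ne_zero hη0 (by positivity)
  have hCd : C * d ≤ η := by
    rw [hd, mul_div_assoc', div_le_iff₀ (by positivity), mul_comm]
    gcongr
    exact le_self_add
  refine ⟨s * (C * d⁻¹ ^ p), fun {Ω} _ P Z hZ hind _ => ?_⟩
  set A := ∫⁻ ω, (∑ a, Z a ω) ^ (1 + p) ∂P with hAdef
  set B := ∑ a, ∫⁻ ω, Z a ω ^ (1 + p) ∂P with hBdef
  set c := ∑ a, ∫⁻ ω, Z a ω ∂P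
  have hS : Measurable fun ω => ∑ a, Z a ω := Finset.measurable_fun_sum _ fun a _ => hZ a
  by_cases hB : B = ∞
  · rw [hB, ENNReal.mul_top (by simpa using hs0)]; simp
  have hA : A ≠ ∞ := by
    refine ne_top_of_le_ne_top (b := (Fintype.card ι : ℝ≥0∞) ^ (1 + p - 1) * B) ?_ ?_
    · exact ENNReal.mul_ne_top
        (ENNReal.rpow_ne_top_of_nonneg (by linarith) (ENNReal.natCast_ne_top _)) hB
    · rw [hBdef, ← lintegral_finsetSum _ fun a _ => (hZ a).pow_const _,
        ← lintegral_const_mul _ (Finset.measurable_fun_sum _ fun a _ => (hZ a).pow_const _)]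
      exact lintegral_mono fun ω => sum_rpow_le_const_mul _ hq
  -- With `S = ∑ b, Z b`, write `S ^ q = ∑ a, Z a * S ^ p` and split `S = Z a + T`, where `T` is
  -- independent of `Z a`.
  have hterm (a : ι) : ∫⁻ ω, Z a ω * (∑ b, Z b ω) ^ p ∂P ≤
      s * ∫⁻ ω, Z a ω ^ (1 + p) ∂P +
        C * ((∫⁻ ω, Z a ω ∂P) * ∫⁻ ω, (∑ b, Z b ω) ^ p ∂P) := by
    set T : Ω → ℝ≥0∞ := fun ω => ∑ b ∈ Finset.univ.erase a, Z b ω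
    have hTm : Measurable T := Finset.measurable_fun_sum _ fun a _ => hZ a
    have hsplit (ω) : ∑ b, Z b ω = Z a ω + T ω :=
      (Finset.add_sum_erase _ (fun b => Z b ω) (Finset.mem_univ a)).symm
    have hi : ∫⁻ ω, Z a ω * T ω ^ p ∂P = (∫⁻ ω, Z a ω ∂P) * ∫⁻ ω, T ω ^ p ∂P :=
      lintegral_mul_eq_lintegral_mul_lintegral_of_indepFun (hZ a) (hTm.pow_const p)
        ((hind a).comp measurable_id (measurable_id.pow_const p))
    calc ∫⁻ ω, Z a ω * (∑ b, Z b ω) ^ p ∂P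
        ≤ ∫⁻ ω, (s * Z a ω ^ (1 + p) + C * (Z a ω * T ω ^ p)) ∂P := by
          refine lintegral_mono fun ω => ?_
          simp only [hsplit, ENNReal.rpow_add_of_nonneg _ _ zero_le_one hp, ENNReal.rpow_one]
          calc Z a ω * (Z a ω + T ω) ^ p ≤ Z a ω * (s * Z a ω ^ p + C * T ω ^ p) := by
                gcongr; exact hC _ _
            _ = _ := by ring
      _ = s * ∫⁻ ω, Z a ω ^ (1 + p) ∂P + C * ((∫⁻ ω, Z a ω ∂P) * ∫⁻ ω, T ω ^ p ∂P) := by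
          rw [lintegral_add_left (((hZ a).pow_const _).const_mul _),
            lintegral_const_mul _ ((hZ a).pow_const _),
            lintegral_const_mul _ (by fun_prop : Measurable fun ω => Z a ω * T ω ^ p), hi]
      _ ≤ _ := by
          gcongr with ω
          rw [hsplit]; exact le_add_self
  have hcS : c * ∫⁻ ω, (∑ b, Z b ω) ^ p ∂P ≤ d * A + (d⁻¹ ^ p : ℝ≥0) * c ^ (1 + p) := by
    rw [← lintegral_const_mul _ (hS.pow_const _), hAdef,
      ← lintegral_const_mul _ (hS.pow_const _)]
    calc _ ≤ ∫⁻ ω, (d * (∑ b, Z b ω) ^ (1 + p) + (d⁻¹ ^ p : ℝ≥0) * c ^ (1 + p)) ∂P :=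
          lintegral_mono fun ω => mul_rpow_le_add hp hd0 _ _
      _ = _ := by
          rw [lintegral_add_right _ measurable_const, lintegral_const, measure_univ, mul_one]
  have hmain : A ≤ (s * B + ((C * d⁻¹ ^ p : ℝ≥0) : ℝ≥0∞) * c ^ (1 + p)) + (η : ℝ≥0∞) * A := by
    calc A = ∑ a, ∫⁻ ω, Z a ω * (∑ b, Z b ω) ^ p ∂P := by
          rw [← lintegral_finsetSum _ fun a _ =>
            (by fun_prop : Measurable fun ω => Z a ω * (∑ b, Z b ω) ^ p)]
          simp only [hAdef, ENNReal.rpow_add_of_nonneg _ _ zero_le_one hp, ENNReal.rpow_one,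
            Finset.sum_mul]
      _ ≤ ∑ a, (s * ∫⁻ ω, Z a ω ^ (1 + p) ∂P +
            C * ((∫⁻ ω, Z a ω ∂P) * ∫⁻ ω, (∑ b, Z b ω) ^ p ∂P)) :=
          Finset.sum_le_sum fun a _ => hterm a
      _ = s * B + C * (c * ∫⁻ ω, (∑ b, Z b ω) ^ p ∂P) := by
          rw [Finset.sum_add_distrib, ← Finset.mul_sum, ← Finset.mul_sum, ← Finset.sum_mul]
      _ ≤ s * B + C * (d * A + (d⁻¹ ^ p : ℝ≥0) * c ^ (1 + p)) := by gcongr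
      _ = (s * B + ((C * d⁻¹ ^ p : ℝ≥0) : ℝ≥0∞) * c ^ (1 + p)) + ((C * d : ℝ≥0) : ℝ≥0∞) * A := by
          push_cast; ring
      _ ≤ _ := by gcongr
  calc A ≤ s * (s * B + ((C * d⁻¹ ^ p : ℝ≥0) : ℝ≥0∞) * c ^ (1 + p)) :=
        le_mul_of_le_add hs hA hmain
    _ = _ := by push_cast; ring

/-! ### Weighted sums over the word tree -/

section TreeSum

/-- The sum, over the descendants `u ++ v` of `u` with `|v| = n`, of the weight `c (u ++ v)` times
the product of `w` along the path from `u` (excluded) to `u ++ v` (included). -/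
noncomputable def treeSum {m : ℕ} (w c : List (Fin m) → ℝ≥0∞) : ℕ → List (Fin m) → ℝ≥0∞
  | 0, u => c u
  | n + 1, u => ∑ a, w (u ++ [a]) * treeSum w c n (u ++ [a])

theorem sum_vector_succ {α M : Type*} [Fintype α] [AddCommMonoid M] (n : ℕ) (f : List α → M) :
    ∑ v : List.Vector α (n + 1), f v.toList = ∑ a, ∑ v : List.Vector α n, f (a :: v.toList) := by
  rw [← Fintype.sum_prod_type']
  refine Fintype.sum_equiv
    ⟨fun v => (v.head, v.tail), fun x => x.1 ::ᵥ x.2, fun v => by simp, fun x => by simp⟩ _ _ ?_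
  intro v
  obtain ⟨a, v, rfl⟩ := v.exists_eq_cons
  simp

theorem treeSum_eq_sum {m : ℕ} (w c : List (Fin m) → ℝ≥0∞) (n : ℕ) (u : List (Fin m)) :
    treeSum w c n u = ∑ v : List.Vector (Fin m) n,
      (∏ r ∈ Finset.range n, w (u ++ v.toList.take (r + 1))) * c (u ++ v.toList) := by
  induction n generalizing u with
  | zero =>
    simp [treeSum]
  | succ n ih =>
    rw [sum_vector_succ n fun v =>
      (∏ r ∈ Finset.range (n + 1), w (u ++ v.take (r + 1))) * c (u ++ v)]
    simp only [treeSum, ih, Finset.mul_sum, Finset.prod_range_succ', List.take_succ_cons,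
      List.append_assoc, List.singleton_append, List.take_zero]
    refine Finset.sum_congr rfl fun a _ => Finset.sum_congr rfl fun v _ => ?_
    ring

variable {m : ℕ} {w c : List (Fin m) → ℝ≥0∞}

theorem treeSum_succ (w c : List (Fin m) → ℝ≥0∞) (n : ℕ) (u : List (Fin m)) :
    treeSum w c (n + 1) u = ∑ a, w (u ++ [a]) * treeSum w c n (u ++ [a]) := rfl

/-- For level moments, `1 ≤ w` is Jensen and `hc` is convexity; the bound propagates infinite values
to deeper levels. -/
theorem treeSum_le_mul_succ {K : ℝ≥0∞} (hw : ∀ u, 1 ≤ w u)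
    (hc : ∀ u, c u ≤ K * ∑ a, c (u ++ [a])) (n : ℕ) (u : List (Fin m)) :
    treeSum w c n u ≤ K * treeSum w c (n + 1) u := by
  induction n generalizing u with
  | zero =>
    refine (hc u).trans ?_
    simp only [treeSum]
    gcongr with a
    exact le_mul_of_one_le_left' (hw _)
  | succ n ih =>
    rw [treeSum_succ w c n, treeSum_succ w c (n + 1), Finset.mul_sum]
    refine Finset.sum_le_sum fun a _ => ?_
    calc _ ≤ w (u ++ [a]) * (K * treeSum w c (n + 1) (u ++ [a])) := by gcongr; exact ih _
      _ = _ := by ring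

/-! ### Independence of subtrees and moment recursion -/

section Independence

variable {Ω : Type*} {w : List (Fin m) → Ω → ℝ≥0∞}

theorem measurable_treeSum_iSup (S : Set (List (Fin m))) (n : ℕ) (u : List (Fin m))
    (hS : ∀ v, v ≠ [] → u ++ v ∈ S) :
    Measurable[⨆ i ∈ S, MeasurableSpace.comap (w i) inferInstance]
      fun ω => treeSum (fun v => w v ω) c n u := by
  induction n generalizing u with
  | zero => exact measurable_const
  | succ n ih =>
    refine Finset.measurable_fun_sum _ fun a _ => Measurable.mul ?_ ?_
    · exact (Measurable.of_comap_le le_rfl).mono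
        (le_iSup₂_of_le (u ++ [a]) (hS _ (by simp)) le_rfl) le_rfl
    · exact ih _ fun v _ => by simpa using hS (a :: v) (by simp)

theorem measurable_mul_treeSum_iSup (S : Set (List (Fin m))) (n : ℕ) (u : List (Fin m))
    (hS : ∀ v, u ++ v ∈ S) :
    Measurable[⨆ i ∈ S, MeasurableSpace.comap (w i) inferInstance]
      fun ω => w u ω * treeSum (fun v => w v ω) c n u :=
  Measurable.mul
    ((Measurable.of_comap_le le_rfl).mono
      (le_iSup₂_of_le u (by simpa using hS []) le_rfl) le_rfl)
    (measurable_treeSum_iSup S n u fun v _ => hS v)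

variable [MeasurableSpace Ω] {P : Measure Ω}

theorem indepFun_of_measurable_iSup (hw : ∀ i, Measurable (w i)) (hind : iIndepFun w P)
    {S T : Set (List (Fin m))} (hST : Disjoint S T) {f g : Ω → ℝ≥0∞}
    (hf : Measurable[⨆ i ∈ S, MeasurableSpace.comap (w i) inferInstance] f)
    (hg : Measurable[⨆ i ∈ T, MeasurableSpace.comap (w i) inferInstance] g) :
    IndepFun f g P :=
  indep_of_indep_of_le_left
    (indep_of_indep_of_le_right
      (indep_iSup_of_disjoint (fun i => (hw i).comap_le) hind hST) hg.comap_le) hf.comap_le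

theorem measurable_treeSum (hw : ∀ i, Measurable (w i)) (n : ℕ) (u : List (Fin m)) :
    Measurable fun ω => treeSum (fun v => w v ω) c n u :=
  (measurable_treeSum_iSup Set.univ n u fun _ _ => trivial).mono
    (iSup₂_le fun i _ => (hw i).comap_le) le_rfl

theorem indepFun_treeSum (hw : ∀ i, Measurable (w i)) (hind : iIndepFun w P) (n : ℕ)
    (u : List (Fin m)) : IndepFun (w u) (fun ω => treeSum (fun v => w v ω) c n u) P := by
  refine indepFun_of_measurable_iSup hw hind (S := {u}) (T := {u}ᶜ) disjoint_compl_right ?_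
    (measurable_treeSum_iSup _ n u fun v hv => by simpa using hv)
  exact (Measurable.of_comap_le le_rfl).mono (le_iSup₂_of_le u rfl le_rfl) le_rfl

/-- Only weights at words extending `u ++ [a]` enter the first function, and none of them enters the
second. -/
theorem indepFun_mul_treeSum_sum_erase (hw : ∀ i, Measurable (w i)) (hind : iIndepFun w P)
    (n : ℕ) (u : List (Fin m)) (a : Fin m) :
    IndepFun (fun ω => w (u ++ [a]) ω * treeSum (fun v => w v ω) c n (u ++ [a]))
      (fun ω => ∑ b ∈ Finset.univ.erase a,
        w (u ++ [b]) ω * treeSum (fun v => w v ω) c n (u ++ [b])) P := by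
  refine indepFun_of_measurable_iSup hw hind
    (S := {v | (u ++ [a]) <+: v}) (T := {v | (u ++ [a]) <+: v}ᶜ) disjoint_compl_right
    (measurable_mul_treeSum_iSup _ n _ fun v => List.prefix_append _ _) ?_
  refine Finset.measurable_fun_sum _ fun b hb => measurable_mul_treeSum_iSup _ n _ fun v h => ?_
  have hba : b ≠ a := Finset.ne_of_mem_erase hb
  simp only [Set.mem_ofPred_eq, List.append_assoc, List.prefix_append_right_inj,
    List.singleton_append, List.cons_prefix_cons] at h
  exact hba h.1.symm

theorem lintegral_mul_treeSum_rpow (hw : ∀ i, Measurable (w i)) (hind : iIndepFun w P)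
    (q : ℝ) (hq : 0 ≤ q) (n : ℕ) (u : List (Fin m)) :
    ∫⁻ ω, (w u ω * treeSum (fun v => w v ω) c n u) ^ q ∂P =
      (∫⁻ ω, w u ω ^ q ∂P) * ∫⁻ ω, treeSum (fun v => w v ω) c n u ^ q ∂P := by
  simp only [ENNReal.mul_rpow_of_nonneg _ _ hq]
  exact lintegral_mul_eq_lintegral_mul_lintegral_of_indepFun ((hw u).pow_const q)
    ((measurable_treeSum hw n u).pow_const q)
    ((indepFun_treeSum hw hind n u).comp (measurable_id.pow_const q) (measurable_id.pow_const q))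

theorem lintegral_mul_treeSum (hw : ∀ i, Measurable (w i)) (hind : iIndepFun w P)
    (n : ℕ) (u : List (Fin m)) :
    ∫⁻ ω, w u ω * treeSum (fun v => w v ω) c n u ∂P =
      (∫⁻ ω, w u ω ∂P) * ∫⁻ ω, treeSum (fun v => w v ω) c n u ∂P := by
  simpa using lintegral_mul_treeSum_rpow (c := c) hw hind 1 zero_le_one n u

theorem lintegral_treeSum [IsProbabilityMeasure P] (hw : ∀ i, Measurable (w i))
    (hind : iIndepFun w P) (hmean : ∀ i, ∫⁻ ω, w i ω ∂P = 1)
    (hc : ∀ u, ∑ a, c (u ++ [a]) = c u) (n : ℕ) (u : List (Fin m)) :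
    ∫⁻ ω, treeSum (fun v => w v ω) c n u ∂P = c u := by
  induction n generalizing u with
  | zero => simp [treeSum]
  | succ n ih =>
    simp only [treeSum]
    rw [lintegral_finsetSum _ fun a _ => ((hw (u ++ [a])).fun_mul (measurable_treeSum hw n _))]
    simp only [lintegral_mul_treeSum hw hind, hmean, ih, one_mul, hc]

/-- The `q`-th moment of a cascade is bounded by a geometrically weighted sum of the total `q`-th
moments of its levels, with ratio arbitrarily close to `1`. -/
theorem exists_lintegral_treeSum_rpow_le [IsProbabilityMeasure P] (hw : ∀ i, Measurable (w i))
    (hind : iIndepFun w P) (hmean : ∀ i, ∫⁻ ω, w i ω ∂P = 1)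
    (hc : ∀ u, ∑ a, c (u ++ [a]) = c u) {q : ℝ} (hq : 1 ≤ q) {s : ℝ≥0} (hs : 1 < s) :
    ∃ K : ℝ≥0, ∀ n u, ∫⁻ ω, treeSum (fun v => w v ω) c n u ^ q ∂P ≤
      K * ∑ j ∈ Finset.range (n + 1),
        ((s : ℝ≥0∞) ^ 2) ^ j * treeSum (fun v => ∫⁻ ω, w v ω ^ q ∂P) (fun v => c v ^ q) j u := by
  obtain ⟨K, hK⟩ := exists_lintegral_sum_rpow_le (ι := Fin m) hq hs
  refine ⟨K + 1, fun n => ?_⟩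
  induction n with
  | zero =>
    intro u
    simp only [treeSum, lintegral_const, measure_univ, mul_one, zero_add, Finset.range_one,
      Finset.sum_singleton, pow_zero, one_mul]
    refine le_mul_of_one_le_left' ?_
    exact_mod_cast le_add_self
  | succ n ih =>
    intro u
    set M := treeSum (fun v => ∫⁻ ω, w v ω ^ q ∂P) (fun v => c v ^ q) with hM
    have hstep := hK P
      (fun a ω => w (u ++ [a]) ω * treeSum (fun v => w v ω) c n (u ++ [a]))
      (fun a => (hw _).fun_mul (measurable_treeSum hw n _))
      (fun a => indepFun_mul_treeSum_sum_erase hw hind n u a) inferInstance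
    simp only [lintegral_mul_treeSum_rpow hw hind q (zero_le_one.trans hq),
      lintegral_mul_treeSum hw hind, lintegral_treeSum hw hind hmean hc, hmean, one_mul, hc]
      at hstep
    calc _ ≤ _ := hstep
      _ ≤ (s : ℝ≥0∞) ^ 2 * ∑ a, (∫⁻ ω, w (u ++ [a]) ω ^ q ∂P) * (((K + 1 : ℝ≥0) : ℝ≥0∞) *
            ∑ j ∈ Finset.range (n + 1), ((s : ℝ≥0∞) ^ 2) ^ j * M j (u ++ [a])) +
            ((K + 1 : ℝ≥0) : ℝ≥0∞) * c u ^ q := by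
          gcongr with a
          · exact ih _
          · exact le_self_add
      _ = _ := by
          -- The mean term is the `j = 0` summand; the children's sums shift to `j + 1`.
          rw [Finset.sum_range_succ', mul_add]
          congr 1
          · simp only [hM, treeSum, Finset.mul_sum]
            rw [Finset.sum_comm]
            refine Finset.sum_congr rfl fun j _ => Finset.sum_congr rfl fun a _ => ?_
            ring
          · simp [hM, treeSum]

end Independence

end TreeSum

/-! ### Cylinders and their measures -/

theorem mem_cylinder_append_singleton {m : ℕ} {u : List (Fin m)} {a : Fin m} {x : ℕ → Fin m} :
    x ∈ cylinder (u ++ [a]) ↔ x ∈ cylinder u ∧ x u.length = a := by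
  simp only [cylinder, Set.mem_ofPred_eq, List.length_append, List.length_singleton]
  constructor
  · intro h
    refine ⟨fun r hr => ?_, ?_⟩
    · simpa [List.getElem_append_left hr] using h r (by omega)
    · simpa using h u.length (by omega)
  · rintro ⟨h, h'⟩ r hr
    rcases Nat.lt_succ_iff_lt_or_eq.1 hr with h1 | rfl
    · simpa [List.getElem_append_left h1] using h r h1
    · simpa using h'

theorem measurableSet_cylinder {m : ℕ} (u : List (Fin m)) : MeasurableSet (cylinder u) := by
  have : cylinder u = ⋂ (r : ℕ) (hr : r < u.length), (fun x : ℕ → Fin m => x r) ⁻¹' {u[r]} := by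
    ext x
    simp [cylinder]
  rw [this]
  exact MeasurableSet.iInter fun r => MeasurableSet.iInter fun _ =>
    measurable_pi_apply r (measurableSet_singleton _)

theorem sum_measure_cylinder_append {m : ℕ} (μ : Measure (ℕ → Fin m)) (u : List (Fin m)) :
    ∑ a, μ (cylinder (u ++ [a])) = μ (cylinder u) := by
  have h : cylinder u = ⋃ a, cylinder (u ++ [a]) := by
    ext x
    simp [mem_cylinder_append_singleton]
  rw [h, measure_iUnion _ fun a => measurableSet_cylinder _, tsum_fintype]
  intro a b hab
  refine Set.disjoint_left.2 fun x hx hy => hab ?_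
  rw [mem_cylinder_append_singleton] at hx hy
  exact hx.2.symm.trans hy.2

/-! ### From real cascades to tree sums -/

section Comparison

variable {m : ℕ} {Ω : Type*} {W : List (Fin m) → Ω → ℝ} {μ : Measure (ℕ → Fin m)}
  {q : ℝ} {ω : Ω}

theorem Y_nonneg (hω : ∀ i, 0 < W i ω) (i : List (Fin m)) : 0 ≤ Y W μ i ω :=
  mul_nonneg (Finset.prod_nonneg fun _ _ => (hω _).le) measureReal_nonneg

variable [IsFiniteMeasure μ]

theorem ofReal_Y (hω : ∀ i, 0 < W i ω) (i : List (Fin m)) :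
    ENNReal.ofReal (Y W μ i ω) =
      (∏ r ∈ Finset.range i.length, ENNReal.ofReal (W (i.take (r + 1)) ω)) * μ (cylinder i) := by
  rw [Y, X, ENNReal.ofReal_mul (Finset.prod_nonneg fun _ _ => (hω _).le),
    ENNReal.ofReal_prod_of_nonneg fun _ _ => (hω _).le, ofReal_measureReal]

theorem ofReal_sum_Y_rpow (hω : ∀ i, 0 < W i ω) (hq : 0 ≤ q) (k : ℕ) :
    ENNReal.ofReal ((∑ i : List.Vector (Fin m) k, Y W μ i.toList ω) ^ q) =
      treeSum (fun v => ENNReal.ofReal (W v ω)) (fun v => μ (cylinder v)) k [] ^ q := by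
  rw [← ENNReal.ofReal_rpow_of_nonneg (Finset.sum_nonneg fun i _ => Y_nonneg hω _) hq,
    ENNReal.ofReal_sum_of_nonneg fun i _ => Y_nonneg hω _, treeSum_eq_sum]
  simp [ofReal_Y hω]

theorem lintegral_ofReal_Y_rpow [MeasurableSpace Ω] {P : Measure Ω}
    (hW : ∀ i, Measurable (W i)) (hind : iIndepFun W P) (hpos : ∀ᵐ ω ∂P, ∀ i, 0 < W i ω)
    (hq : 0 ≤ q) (i : List (Fin m)) :
    ∫⁻ ω, ENNReal.ofReal (Y W μ i ω ^ q) ∂P =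
      (∏ r ∈ Finset.range i.length, ∫⁻ ω, ENNReal.ofReal (W (i.take (r + 1)) ω) ^ q ∂P) *
        μ (cylinder i) ^ q := by
  have hae : ∀ᵐ ω ∂P, ENNReal.ofReal (Y W μ i ω ^ q) =
      (∏ r : Fin i.length, ENNReal.ofReal (W (i.take (r + 1)) ω) ^ q) * μ (cylinder i) ^ q := by
    filter_upwards [hpos] with ω hω
    rw [← ENNReal.ofReal_rpow_of_nonneg (Y_nonneg hω i) hq, ofReal_Y hω,
      ENNReal.mul_rpow_of_nonneg _ _ hq, ENNReal.prod_rpow_of_nonneg hq, Finset.prod_range]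
  -- Distinct prefixes carry distinct, hence independent, weights.
  have hinj : Function.Injective fun r : Fin i.length => i.take (r + 1) := by
    intro r s hrs
    have := congrArg List.length hrs
    simp only [List.length_take] at this
    omega
  have hf : Measurable fun x : ℝ => ENNReal.ofReal x ^ q :=
    ENNReal.measurable_ofReal.pow_const q
  rw [lintegral_congr_ae hae, lintegral_mul_const _
      (by fun_prop : Measurable fun ω =>
        ∏ r : Fin i.length, ENNReal.ofReal (W (i.take (r + 1)) ω) ^ q),
    lintegral_prod_eq_prod_lintegral_of_indepFun Finset.univ
      (fun (r : Fin i.length) ω => ENNReal.ofReal (W (i.take (r + 1)) ω) ^ q)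
      ((hind.precomp hinj).comp (fun _ x => ENNReal.ofReal x ^ q) fun _ => hf)
      fun r => hf.comp (hW _), Finset.prod_range]

theorem sum_lintegral_ofReal_Y_rpow [MeasurableSpace Ω] {P : Measure Ω}
    (hW : ∀ i, Measurable (W i)) (hind : iIndepFun W P) (hpos : ∀ᵐ ω ∂P, ∀ i, 0 < W i ω)
    (hq : 0 ≤ q) (k : ℕ) :
    ∑ i : List.Vector (Fin m) k, ∫⁻ ω, ENNReal.ofReal (Y W μ i.toList ω ^ q) ∂P =
      treeSum (fun v => ∫⁻ ω, ENNReal.ofReal (W v ω) ^ q ∂P) (fun v => μ (cylinder v) ^ q) k [] := by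
  simp [treeSum_eq_sum, lintegral_ofReal_Y_rpow hW hind hpos hq]

end Comparison

/-! ### Root test and finiteness of level moments -/

theorem one_le_lintegral_rpow {Ω : Type*} [MeasurableSpace Ω] {P : Measure Ω}
    [IsProbabilityMeasure P] {f : Ω → ℝ≥0∞} (hf : Measurable f) (hmean : ∫⁻ ω, f ω ∂P = 1)
    {q : ℝ} (hq : 1 ≤ q) : 1 ≤ ∫⁻ ω, f ω ^ q ∂P := by
  have h := eLpNorm'_le_eLpNorm'_of_exponent_le zero_lt_one hq P hf.aestronglyMeasurable
  simp only [eLpNorm'_eq_lintegral_enorm, enorm_eq_self, ENNReal.rpow_one, hmean, div_one] at h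
  rwa [← ENNReal.one_rpow (1 / q), ENNReal.rpow_le_rpow_iff (by positivity)] at h

/-- The root test, uniformly over partial sums, with room for a ratio slightly larger than `1`. -/
theorem exists_tsum_pow_mul_lt_top {M : ℕ → ℝ≥0∞} (hM : ∀ k, M k ≠ ∞)
    (h : limsup (fun k : ℕ => M k ^ (1 / (k : ℝ))) atTop < 1) :
    ∃ s : ℝ≥0, 1 < s ∧ ∑' k, ((s : ℝ≥0∞) ^ 2) ^ k * M k < ∞ := by
  obtain ⟨r, hr, hr1⟩ := ENNReal.lt_iff_exists_nnreal_btwn.1 h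
  have hr1 : r < 1 := by exact_mod_cast hr1
  have hr0 : 0 < r := by exact_mod_cast (zero_le.trans_lt hr)
  obtain ⟨N, hN⟩ := eventually_atTop.1 (eventually_lt_of_limsup_lt hr)
  obtain ⟨s, hs1, t, ht1, hsr⟩ : ∃ s : ℝ≥0, 1 < s ∧ ∃ t : ℝ≥0, t < 1 ∧ s ^ 2 * r = t := by
    have hlt {x : ℝ≥0} (hx : x < 1) : NNReal.sqrt x < 1 := by
      simpa using NNReal.sqrt_lt_sqrt.2 hx
    have ht0 : 0 < NNReal.sqrt r := NNReal.sqrt_pos.2 hr0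
    -- `s = r ^ (-1/4)` gives `s ^ 2 * r = r ^ (1/2) < 1`.
    refine ⟨(NNReal.sqrt (NNReal.sqrt r))⁻¹,
      (one_lt_inv₀ (NNReal.sqrt_pos.2 ht0)).2 (hlt (hlt hr1)), NNReal.sqrt r, hlt hr1, ?_⟩
    rw [inv_pow, NNReal.sq_sqrt, inv_mul_eq_iff_eq_mul₀ ht0.ne', ← sq, NNReal.sq_sqrt]
  have hsr' : (s : ℝ≥0∞) ^ 2 * r = t := by exact_mod_cast congrArg ((↑) : ℝ≥0 → ℝ≥0∞) hsr
  refine ⟨s, hs1, ?_⟩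
  have hbound (k : ℕ) : ((s : ℝ≥0∞) ^ 2) ^ (k + (N + 1)) * M (k + (N + 1)) ≤ (t : ℝ≥0∞) ^ k := by
    set n := k + (N + 1) with hn
    have hn0 : (n : ℝ) ≠ 0 := by positivity
    have hMn : M n ≤ (r : ℝ≥0∞) ^ n := by
      calc M n = (M n ^ (1 / (n : ℝ))) ^ (n : ℝ) := by
            rw [← ENNReal.rpow_mul, one_div_mul_cancel hn0, ENNReal.rpow_one]
        _ ≤ (r : ℝ≥0∞) ^ (n : ℝ) := by
            gcongr
            exact (hN n (by omega)).le
        _ = _ := ENNReal.rpow_natCast _ _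
    calc ((s : ℝ≥0∞) ^ 2) ^ n * M n ≤ ((s : ℝ≥0∞) ^ 2) ^ n * (r : ℝ≥0∞) ^ n := by gcongr
      _ = (t : ℝ≥0∞) ^ n := by rw [← mul_pow, hsr']
      _ ≤ _ := pow_le_pow_right_of_le_one' (by exact_mod_cast ht1.le) (by omega)
  have hsplit := Summable.sum_add_tsum_nat_add' (f := fun k => ((s : ℝ≥0∞) ^ 2) ^ k * M k)
    (k := N + 1) ENNReal.summable
  have hhead : ∑ k ∈ Finset.range (N + 1), ((s : ℝ≥0∞) ^ 2) ^ k * M k < ∞ :=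
    ENNReal.sum_lt_top.2 fun k _ =>
      ENNReal.mul_lt_top (ENNReal.pow_lt_top (ENNReal.pow_lt_top ENNReal.coe_lt_top))
        (hM k).lt_top
  have htail : ∑' k, ((s : ℝ≥0∞) ^ 2) ^ (k + (N + 1)) * M (k + (N + 1)) < ∞ := by
    refine (ENNReal.tsum_le_tsum hbound).trans_lt ?_
    rw [ENNReal.tsum_geometric]
    exact ENNReal.inv_lt_top.2 (tsub_pos_of_lt (by exact_mod_cast ht1))
  rw [← hsplit]
  exact ENNReal.add_lt_top.2 ⟨hhead, htail⟩

/-- One infinite term would make all later ones infinite. The root test needs this for its initial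
terms, which the limsup does not control. -/
theorem ne_top_of_limsup_lt_one {M : ℕ → ℝ≥0∞} {K : ℝ≥0∞} (hK : K ≠ ∞)
    (hM : ∀ k, M k ≤ K * M (k + 1))
    (h : limsup (fun k : ℕ => M k ^ (1 / (k : ℝ))) atTop < 1) (k : ℕ) : M k ≠ ∞ := by
  intro hk
  have htop (n : ℕ) (hn : k ≤ n) : M n = ∞ := by
    induction n, hn using Nat.le_induction with
    | base => exact hk
    | succ n _ ih =>
      by_contra hne
      exact ENNReal.mul_ne_top hK hne (top_le_iff.1 (ih ▸ hM n))
  obtain ⟨N, hN⟩ := eventually_atTop.1 (eventually_lt_of_limsup_lt h)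
  have h1 := hN (max k N + 1) (by omega)
  rw [htop _ (by omega), ENNReal.top_rpow_of_pos (by positivity)] at h1
  exact absurd h1 (by simp)

end Cascade

theorem proposition4p2 {m : ℕ} {Ω : Type*} [MeasurableSpace Ω]
    (P : Measure Ω) [IsProbabilityMeasure P]
    (W : List (Fin m) → Ω → ℝ)
    (hW_meas : ∀ i, Measurable (W i))
    (hW_indep : iIndepFun W P)
    (hW_pos : ∀ i, ∀ᵐ ω ∂P, 0 < W i ω)
    (hW_mean : ∀ i, ∫ ω, W i ω ∂P = 1)
    (μ : Measure (ℕ → Fin m)) [IsProbabilityMeasure μ]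
    (q : ℝ) (hq : 1 ≤ q)
    (h : limsup (fun k : ℕ =>
        (∑ i : List.Vector (Fin m) k,
          ∫⁻ ω, ENNReal.ofReal (Cascade.Y W μ i.toList ω ^ q) ∂P) ^ (1 / (k : ℝ))) atTop < 1) :
    limsup (fun k : ℕ =>
        ∫⁻ ω, ENNReal.ofReal ((∑ i : List.Vector (Fin m) k, Cascade.Y W μ i.toList ω) ^ q) ∂P)
        atTop < ⊤ ∧
      (⨆ k : ℕ,
        ∫⁻ ω, ENNReal.ofReal ((∑ i : List.Vector (Fin m) k, Cascade.Y W μ i.toList ω) ^ q) ∂P)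
        < ⊤ := by
  have hq0 : 0 ≤ q := zero_le_one.trans hq
  have hpos : ∀ᵐ ω ∂P, ∀ i, 0 < W i ω := ae_all_iff.2 hW_pos
  suffices hsup : (⨆ k : ℕ,
      ∫⁻ ω, ENNReal.ofReal ((∑ i : List.Vector (Fin m) k, Cascade.Y W μ i.toList ω) ^ q) ∂P) < ⊤
    from ⟨limsup_le_iSup.trans_lt hsup, hsup⟩
  set w : List (Fin m) → Ω → ENNReal := fun i ω => ENNReal.ofReal (W i ω) with hw
  have hw_meas (i) : Measurable (w i) := (hW_meas i).ennreal_ofReal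
  have hw_indep : iIndepFun w P :=
    hW_indep.comp (fun _ x => ENNReal.ofReal x) fun _ => ENNReal.measurable_ofReal
  have hw_mean (i) : ∫⁻ ω, w i ω ∂P = 1 := by
    rw [hw, ← ofReal_integral_eq_lintegral_ofReal, hW_mean, ENNReal.ofReal_one]
    -- A non-integrable function has Bochner integral `0`, so mean `1` forces integrability.
    · exact Integrable.of_integral_ne_zero (by simp [hW_mean])
    · filter_upwards [hW_pos i] with ω hω using hω.le
  have hc := Cascade.sum_measure_cylinder_append μ
  simp only [Cascade.sum_lintegral_ofReal_Y_rpow hW_meas hW_indep hpos hq0] at h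
  have hfin := Cascade.ne_top_of_limsup_lt_one
    (ENNReal.rpow_ne_top_of_nonneg (sub_nonneg.2 hq) (ENNReal.natCast_ne_top (Fintype.card (Fin m))))
    (fun k => Cascade.treeSum_le_mul_succ
      (fun u => Cascade.one_le_lintegral_rpow (hw_meas u) (hw_mean u) hq)
      (fun u => by rw [← hc u]; exact Cascade.sum_rpow_le_const_mul _ hq) k []) h
  obtain ⟨s, hs, hsum⟩ := Cascade.exists_tsum_pow_mul_lt_top hfin h
  obtain ⟨K, hK⟩ := Cascade.exists_lintegral_treeSum_rpow_le
    (c := fun v => μ (Cascade.cylinder v)) hw_meas hw_indep hw_mean hc hq hs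
  refine lt_of_le_of_lt (iSup_le fun k => ?_) (ENNReal.mul_lt_top ENNReal.coe_lt_top hsum (a := K))
  rw [lintegral_congr_ae (hpos.mono fun ω hω => Cascade.ofReal_sum_Y_rpow hω hq0 k)]
  refine (hK k []).trans ?_
  gcongr
  exact ENNReal.sum_le_tsum _
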